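/- Let $F$ be a field of characteristic different from $2$, and let $(V,q_V)$ and $(W,q_W)$ be (finite-dimensional) quadratic spaces over $F$, with $q_V$ anisotropic, $q_W$ nondegenerate and $W\neq 0$. Let $F(W)$ be the function field of the affine space $W$, i.e. the field of fractions of the symmetric algebra of the dual $W^*$, and let $F(\mathbb{P}W)\subset F(W)$ be the function field of the projective space of lines in $W$, i.e. the subfield of quotients $a/b$ of homogeneous polynomial functions $a,b$ on $W$ of the same degree, $b\neq 0$. Let $L_W\subset F(\mathbb{P}W)\otimes_F W$ be the generic line: the set of vectors which, over $F(W)$, become multiples of the generic point $\sum_i t_i\otimes e_i$ of $W$ (where $(e_i)$ is any basis of $W$ and $(t_i)$ is the dual basis). Let $q_W^{\mathrm{proj}}\in F(\mathbb{P}W)$ be any element of the square class of $q_W(\delta)$, where $\delta$ is a nonzero vector of $L_W$ (this class does not depend on $\delta$). Then there exists $\lambda\in F^\times$ such that $\lambda q_W$ is a subform of $q_V$ (i.e. $\lambda q_W$ is isometric to the restriction of $q_V$ to some subspace of $V$) if and only if there exists $\lambda\in F^\times$ such that the form $q_V$, extended to $F(\mathbb{P}W)$, represents $\lambda q_W^{\mathrm{proj}}$,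 i.e. takes this value at some vector of $F(\mathbb{P}W)\otimes_F V$. -/

import Mathlib

open scoped TensorProduct

noncomputable section

namespace ProjectiveSubform

/-- The coordinate ring `F[W]` of the affine space `W`: the symmetric algebra of the dual of `W`,
i.e. the ring of polynomial functions on `W`. -/
def CoordRing (F W : Type*) [Field F] [AddCommGroup W] [Module F W] : Type _ :=
  SymmetricAlgebra F (Module.Dual F W)

instance (F W : Type*) [Field F] [AddCommGroup W] [Module F W] : CommRing (CoordRing F W) :=
  inferInstanceAs (CommRing (SymmetricAlgebra F (Module.Dual F W)))

instance (F W : Type*) [Field F] [AddCommGroup W] [Module F W] : Algebra F (CoordRing F W) :=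
  inferInstanceAs (Algebra F (SymmetricAlgebra F (Module.Dual F W)))

instance (F W : Type*) [Field F] [AddCommGroup W] [Module F W] : IsDomain (CoordRing F W) :=
  inferInstanceAs (IsDomain (SymmetricAlgebra F (Module.Dual F W)))

/-- The inclusion of the linear forms on `W` into the coordinate ring. -/
def linearForm (F W : Type*) [Field F] [AddCommGroup W] [Module F W] :
    Module.Dual F W →ₗ[F] CoordRing F W :=
  SymmetricAlgebra.ι F (Module.Dual F W)

/-- The function field `F(W)` of the affine space `W`. -/
def AffineFunctionField (F W : Type*) [Field F] [AddCommGroup W] [Module F W] : Type _ :=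
  FractionRing (CoordRing F W)

instance (F W : Type*) [Field F] [AddCommGroup W] [Module F W] : Field (AffineFunctionField F W) :=
  inferInstanceAs (Field (FractionRing (CoordRing F W)))

instance (F W : Type*) [Field F] [AddCommGroup W] [Module F W] :
    Algebra (CoordRing F W) (AffineFunctionField F W) :=
  inferInstanceAs (Algebra (CoordRing F W) (FractionRing (CoordRing F W)))

instance (F W : Type*) [Field F] [AddCommGroup W] [Module F W] : Algebra F (AffineFunctionField F W) :=
  inferInstanceAs (Algebra F (FractionRing (CoordRing F W)))

instance (F W : Type*) [Field F] [AddCommGroup W] [Module F W] :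
    IsFractionRing (CoordRing F W) (AffineFunctionField F W) :=
  inferInstanceAs (IsFractionRing (CoordRing F W) (FractionRing (CoordRing F W)))

instance (F W : Type*) [Field F] [AddCommGroup W] [Module F W] :
    IsScalarTower F (CoordRing F W) (AffineFunctionField F W) :=
  inferInstanceAs (IsScalarTower F (CoordRing F W) (FractionRing (CoordRing F W)))

/-- The homogeneous polynomial functions of degree `n` on `W`: the span of the products of
`n` linear forms. -/
def homogeneousPart (F W : Type*) [Field F] [AddCommGroup W] [Module F W] (n : ℕ) :
    Submodule F (CoordRing F W) :=
  (LinearMap.range (linearForm F W)) ^ n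

theorem mul_mem_homogeneousPart {F W : Type*} [Field F] [AddCommGroup W] [Module F W] {m n : ℕ}
    {a b : CoordRing F W} (ha : a ∈ homogeneousPart F W m) (hb : b ∈ homogeneousPart F W n) :
    a * b ∈ homogeneousPart F W (m + n) := by
  unfold homogeneousPart at *
  rw [pow_add]
  exact Submodule.mul_mem_mul ha hb

/-- The subfield `F(W)₀` of `F(W)` of rational functions that are homogeneous of degree `0`:
the quotients `a / b` of homogeneous polynomial functions of the same degree.  This is the field
of rational functions on the projective space of lines in `W`. -/
def degreeZeroSubfield (F W : Type*) [Field F] [AddCommGroup W] [Module F W] :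
    IntermediateField F (AffineFunctionField F W) where
  carrier := {x | ∃ n : ℕ, ∃ a ∈ homogeneousPart F W n, ∃ b ∈ homogeneousPart F W n, b ≠ 0 ∧
    x = algebraMap (CoordRing F W) (AffineFunctionField F W) a /
      algebraMap (CoordRing F W) (AffineFunctionField F W) b}
  mul_mem' := by
    rintro _ _ ⟨m, a, ha, b, hb, hb0, rfl⟩ ⟨n, c, hc, d, hd, hd0, rfl⟩
    refine ⟨m + n, a * c, mul_mem_homogeneousPart ha hc, b * d, mul_mem_homogeneousPart hb hd,
      mul_ne_zero hb0 hd0, ?_⟩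
    rw [map_mul, map_mul, div_mul_div_comm]
  add_mem' := by
    rintro _ _ ⟨m, a, ha, b, hb, hb0, rfl⟩ ⟨n, c, hc, d, hd, hd0, rfl⟩
    refine ⟨m + n, a * d + b * c,
      add_mem (mul_mem_homogeneousPart ha hd) (mul_mem_homogeneousPart hb hc),
      b * d, mul_mem_homogeneousPart hb hd, mul_ne_zero hb0 hd0, ?_⟩
    rw [map_add, map_mul, map_mul, map_mul, div_add_div]
    · simpa using hb0
    · simpa using hd0
  algebraMap_mem' r := by
    refine ⟨0, algebraMap F (CoordRing F W) r, ?_, 1, ?_, one_ne_zero, ?_⟩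
    · simp only [homogeneousPart, pow_zero]
      exact Submodule.algebraMap_mem r
    · simp only [homogeneousPart, pow_zero]
      exact Submodule.one_le.mp le_rfl
    · rw [map_one, div_one, ← IsScalarTower.algebraMap_apply]
  inv_mem' := by
    rintro _ ⟨n, a, ha, b, hb, hb0, rfl⟩
    by_cases ha0 : a = 0
    · subst ha0
      exact ⟨n, 0, zero_mem _, b, hb, hb0, by simp⟩
    · exact ⟨n, b, hb, a, ha, ha0, by rw [inv_div]⟩

/-- The function field `F(ℙW)` of the projective space of lines in `W`. -/
def ProjFunctionField (F W : Type*) [Field F] [AddCommGroup W] [Module F W] : Type _ :=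
  ↥(degreeZeroSubfield F W)

instance (F W : Type*) [Field F] [AddCommGroup W] [Module F W] : Field (ProjFunctionField F W) :=
  inferInstanceAs (Field (degreeZeroSubfield F W))

instance (F W : Type*) [Field F] [AddCommGroup W] [Module F W] : Algebra F (ProjFunctionField F W) :=
  inferInstanceAs (Algebra F (degreeZeroSubfield F W))

/-- The inclusion of `F(ℙW)` into `F(W)`. -/
def toAffine (F W : Type*) [Field F] [AddCommGroup W] [Module F W] :
    ProjFunctionField F W →ₐ[F] AffineFunctionField F W :=
  (degreeZeroSubfield F W).val

/-- The inclusion of the linear forms on `W` into the function field `F(W)`. -/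
def linearFunction (F W : Type*) [Field F] [AddCommGroup W] [Module F W] :
    Module.Dual F W →ₗ[F] AffineFunctionField F W :=
  (IsScalarTower.toAlgHom F (CoordRing F W) (AffineFunctionField F W)).toLinearMap ∘ₗ
    linearForm F W

/-- The generic point of the affine space `W`, a vector of `W` extended to `F(W)`: the image of
the identity of `W` under `End(W) ≃ W* ⊗ W → F(W) ⊗ W`.  In a basis `e` of `W` with dual
basis `t`, it is `∑ i, t i ⊗ e i`. -/
def genericPoint (F W : Type*) [Field F] [AddCommGroup W] [Module F W] [FiniteDimensional F W] :
    AffineFunctionField F W ⊗[F] W :=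
  LinearMap.rTensor W (linearFunction F W) ((dualTensorHomEquiv F W W).symm LinearMap.id)

/-- The generic line `L_W` in `W` extended to `F(ℙW)`: the vectors that become
multiples of the generic point of `W` over `F(W)`. -/
def genericLine (F W : Type*) [Field F] [AddCommGroup W] [Module F W] [FiniteDimensional F W] :
    Submodule (ProjFunctionField F W) (ProjFunctionField F W ⊗[F] W) where
  carrier := {x | ∃ c : AffineFunctionField F W,
    LinearMap.rTensor W (toAffine F W).toLinearMap x = c • genericPoint F W}
  add_mem' := by
    rintro x y ⟨c, hc⟩ ⟨d, hd⟩
    exact ⟨c + d, by rw [map_add, hc, hd, add_smul]⟩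
  zero_mem' := ⟨0, by rw [map_zero, zero_smul]⟩
  smul_mem' := by
    rintro r x ⟨c, hc⟩
    refine ⟨toAffine F W r * c, ?_⟩
    rw [mul_smul, ← hc]
    clear hc
    induction x with
    | zero => simp
    | tmul a w => simp [TensorProduct.smul_tmul']
    | add x y hx hy => rw [smul_add, map_add, hx, hy, map_add, smul_add]

/-- The projective class of a quadratic form `q` on `W`: the square class in `F(ℙW)` of the value
of `q` at a nonzero point of the generic line.  An element `q^proj` is an element of this set. -/
def projectiveClass {F W : Type*} [Field F] [Invertible (2 : F)] [AddCommGroup W] [Module F W]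
    [FiniteDimensional F W] (q : QuadraticForm F W) : Set (ProjFunctionField F W) :=
  {a | ∃ δ ∈ genericLine F W, δ ≠ 0 ∧ ∃ c : ProjFunctionField F W, c ≠ 0 ∧
    a = c ^ 2 * q.baseChange (ProjFunctionField F W) δ}

/-- `q` is a subform of `Q`: it is isometric to the restriction of `Q` to a subspace. -/
def IsSubform {F V W : Type*} [Field F] [AddCommGroup V] [Module F V] [AddCommGroup W] [Module F W]
    (q : QuadraticForm F W) (Q : QuadraticForm F V) : Prop :=
  ∃ U : Submodule F V, QuadraticMap.Equivalent q (QuadraticMap.restrict Q U)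

/-- The quadratic form `Q` represents the scalar `a`. -/
def Represents {K V : Type*} [Field K] [AddCommGroup V] [Module K V]
    (Q : QuadraticForm K V) (a : K) : Prop :=
  ∃ v : V, Q v = a

/-- The generic point in a basis. -/
theorem genericPoint_eq_sum {F W : Type*} [Field F] [AddCommGroup W] [Module F W]
    [FiniteDimensional F W] {ι : Type*} [Fintype ι] (b : Module.Basis ι F W) :
    genericPoint F W = ∑ i, linearFunction F W (b.coord i) ⊗ₜ[F] b i := by
  have h : (dualTensorHomEquiv F W W).symm LinearMap.id = ∑ i, b.coord i ⊗ₜ[F] b i := by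
    rw [LinearEquiv.symm_apply_eq]
    refine LinearMap.ext fun w => ?_
    simp [dualTensorHomEquiv, LinearMap.sum_apply, dualTensorHom_apply, b.sum_repr]
  rw [genericPoint, h, map_sum]
  simp

theorem linearFunction_ne_zero {F W : Type*} [Field F] [AddCommGroup W] [Module F W]
    {f : Module.Dual F W} (hf : f ≠ 0) : linearFunction F W f ≠ 0 := by
  intro h
  have h0 : linearForm F W f = 0 := by
    refine IsFractionRing.injective (CoordRing F W) (AffineFunctionField F W) ?_
    rw [map_zero]
    exact h
  refine hf (LinearMap.ext fun w => ?_)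
  have h1 := SymmetricAlgebra.lift_ι_apply (LinearMap.applyₗ w : Module.Dual F W →ₗ[F] F) f
  rw [show SymmetricAlgebra.ι F (Module.Dual F W) f = 0 from h0, map_zero] at h1
  exact h1.symm

/-- In a basis `b` of `W` with dual basis `t`, the vector `∑ i, (t i / t j) ⊗ b i` is a nonzero
point of the generic line. -/
theorem exists_mem_genericLine {F W : Type*} [Field F] [AddCommGroup W] [Module F W]
    [FiniteDimensional F W] {ι : Type*} [Fintype ι] (b : Module.Basis ι F W) (j : ι) :
    ∃ θ : ι → ProjFunctionField F W,
      (∀ i, toAffine F W (θ i) =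
        linearFunction F W (b.coord i) / linearFunction F W (b.coord j)) ∧
      ∑ i, θ i ⊗ₜ[F] b i ∈ genericLine F W ∧ ∑ i, θ i ⊗ₜ[F] b i ≠ 0 := by
  have hj : b.coord j ≠ 0 := fun h => by simpa using congrArg (fun f => f (b j)) h
  have hmem : ∀ f : Module.Dual F W, linearForm F W f ∈ homogeneousPart F W 1 := fun f => by
    simp only [homogeneousPart, pow_one]
    exact LinearMap.mem_range_self _ f
  have hlj : linearForm F W (b.coord j) ≠ 0 := fun h => linearFunction_ne_zero hj (by
    rw [linearFunction, LinearMap.comp_apply, h, map_zero])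
  let θ : ι → ProjFunctionField F W := fun i =>
    ⟨linearFunction F W (b.coord i) / linearFunction F W (b.coord j),
      1, _, hmem _, _, hmem _, hlj, rfl⟩
  have hθ : ∀ i, toAffine F W (θ i) =
      linearFunction F W (b.coord i) / linearFunction F W (b.coord j) := fun i => rfl
  refine ⟨θ, hθ, ⟨(linearFunction F W (b.coord j))⁻¹, ?_⟩, fun h => ?_⟩
  · rw [map_sum, genericPoint_eq_sum b, Finset.smul_sum]
    refine Finset.sum_congr rfl fun i _ => ?_
    rw [LinearMap.rTensor_tmul, TensorProduct.smul_tmul', smul_eq_mul]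
    congr 1
    rw [AlgHom.toLinearMap_apply, hθ, div_eq_inv_mul]
  · have h1 := congrArg (fun x => TensorProduct.rid F (ProjFunctionField F W)
      (LinearMap.lTensor (ProjFunctionField F W) (b.coord j) x)) h
    simp only [map_sum, map_zero, LinearMap.lTensor_tmul, TensorProduct.rid_tmul] at h1
    rw [Finset.sum_eq_single j (fun i _ hi => by simp [hi])
      (fun h => absurd (Finset.mem_univ j) h)] at h1
    have h2 := congrArg (toAffine F W) h1
    simp [hθ, linearFunction_ne_zero hj] at h2

/-- The projective class is not empty. -/
theorem projectiveClass_nonempty {F W : Type*} [Field F] [Invertible (2 : F)] [AddCommGroup W]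
    [Module F W] [FiniteDimensional F W] [Nontrivial W] (q : QuadraticForm F W) :
    (projectiveClass q).Nonempty := by
  obtain ⟨j⟩ := (Module.finBasis F W).index_nonempty
  obtain ⟨θ, -, h, h0⟩ := exists_mem_genericLine (Module.finBasis F W) j
  exact ⟨_, _, h, h0, 1, one_ne_zero, rfl⟩

end ProjectiveSubform

end

/-!
This is a projective version of the Cassels–Pfister subform theorem.

Write `t` for the generic point of `W`. A nonzero vector of the generic line becomes a nonzero
multiple of `t` over `F(W)`, so an element of the projective class of `q_W` is a nonzero square
times `q_W(t)` there (`exists_toAffine_eq_of_mem_projectiveClass`). If `λ q_W` embeds in `q_V`, the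
base change of the embedding to `F(ℙW)` carries the generic line to vectors where `q_V` takes the
required value (`represents_of_isSubform`). Conversely, if `q_V` represents `λ p` over `F(ℙW)`, it
represents `λ q_W(t)` over `F(W)`. In orthogonal bases this says that an anisotropic diagonal form
represents `∑ a i * X i ^ 2` over a rational function field, with all `a i ≠ 0`, and one
has to find orthogonal vectors of lengths `a i` over `F` (`exists_orthogonal_of_rep`).

The variables are removed one at a time. Let `K` be the field of rational functions in all variables
but the first, `X`. Cassels' descent on the degree of the denominator
(`exists_polynomial_rep`) gives a polynomial vector over `K[X]` of length `a 0 * X ^ 2 + b`.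
Anisotropy forces it to be linear, `v X + u`, whence `v` has length `a 0`, `u` has length `b`, and
`u ⟂ v` (`exists_linear_rep`). The value `a 0` is then also taken by a vector `v₀` over `F`,
obtained from the coefficients of a polynomial multiple of `v` in a single degree
(`Anisotropic.exists_rep_of_mvPolynomial`), and a reflection over `K` moves `v` to `v₀` and `u` to
a vector orthogonal to `v₀` (`exists_reflect`). The induction proceeds in the orthogonal
complement of `v₀`. Rather than changing coordinates there, all statements carry a set `S` of
constant vectors to which everything is required to stay orthogonal.
-/

/-! ### Diagonal bilinear forms -/

namespace DiagonalForm

/-- The diagonal bilinear form `∑ i, c i * x i * y i` with weights `c` on `ι → R`. -/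
def wdot {R ι : Type*} [CommRing R] [Fintype ι] (c : ι → R) :
    (ι → R) →ₗ[R] (ι → R) →ₗ[R] R :=
  LinearMap.mk₂ R (fun x y => ∑ i, c i * x i * y i)
    (fun x y z => by simp only [← Finset.sum_add_distrib, Pi.add_apply]; congr! 1; ring)
    (fun r x y => by simp only [Finset.mul_sum, Pi.smul_apply, smul_eq_mul]; congr! 1; ring)
    (fun x y z => by simp only [← Finset.sum_add_distrib, Pi.add_apply]; congr! 1; ring)
    (fun r x y => by simp only [Finset.mul_sum, Pi.smul_apply, smul_eq_mul]; congr! 1; ring)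

section
variable {R ι : Type*} [CommRing R] [Fintype ι]

theorem wdot_apply (c x y : ι → R) : wdot c x y = ∑ i, c i * x i * y i := rfl

theorem wdot_comm (c x y : ι → R) : wdot c x y = wdot c y x := by
  simp only [wdot_apply]
  congr! 1
  ring

theorem wdot_smul_add (c u v : ι → R) (r : R) :
    wdot c (r • v + u) (r • v + u) =
      r ^ 2 * wdot c v v + 2 * r * wdot c u v + wdot c u u := by
  simp only [map_add, LinearMap.add_apply, map_smul, LinearMap.smul_apply, smul_eq_mul,
    wdot_comm c v u]
  ring

theorem map_wdot {S : Type*} [CommRing S] (f : R →+* S) (c x y : ι → R) :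
    f (wdot c x y) = wdot (f ∘ c) (f ∘ x) (f ∘ y) := by
  simp [wdot_apply]

/-- The diagonal form with weights `c` is anisotropic. -/
def Anisotropic (c : ι → R) : Prop := ∀ x, wdot c x x = 0 → x = 0

/-- Reflections act transitively on the vectors of a given nonzero length, so that a vector `u`
orthogonal to `v` can be moved to one orthogonal to `w` when `v` and `w` have the same length.
Vectors orthogonal to `u`, `v` and `w` are also orthogonal to the image of `u`. -/
theorem exists_reflect {K : Type*} [Field K] {c : ι → K} (hc : Anisotropic c)
    {u v w : ι → K} (hvw : wdot c v v = wdot c w w) (huv : wdot c u v = 0) :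
    ∃ u', wdot c u' u' = wdot c u u ∧ wdot c u' w = 0 ∧
      ∀ s, wdot c u s = 0 → wdot c v s = 0 → wdot c w s = 0 → wdot c u' s = 0 := by
  by_cases h : v - w = 0
  · obtain rfl := sub_eq_zero.mp h
    exact ⟨u, rfl, huv, fun s hs _ _ => hs⟩
  have hq : wdot c (v - w) (v - w) ≠ 0 := fun h0 => h (hc _ h0)
  set q := wdot c (v - w) (v - w) with hq'
  have e1 : q = 2 * (wdot c w w - wdot c v w) := by
    rw [hq']
    simp only [map_sub, LinearMap.sub_apply, wdot_comm c w v, hvw]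
    ring
  set t := 2 * wdot c u (v - w) / q
  have ht : t * q = 2 * wdot c u (v - w) := div_mul_cancel₀ _ hq
  -- The image of `u` under the reflection in `v - w`, which exchanges `v` and `w`.
  refine ⟨u - t • (v - w), ?_, ?_, ?_⟩
  · simp only [map_sub, LinearMap.sub_apply, map_smul, LinearMap.smul_apply,
      smul_eq_mul] at ht e1 hq' ⊢
    rw [wdot_comm c v u, wdot_comm c w u]
    linear_combination t * ht - t ^ 2 * hq'
  · have h2 : t * (wdot c w w - wdot c v w) * 2 = - wdot c u w * 2 := by
      simp only [map_sub, huv] at ht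
      linear_combination ht - t * e1
    simp only [map_sub, LinearMap.sub_apply, map_smul, LinearMap.smul_apply, smul_eq_mul]
    have h20 : (2 : K) ≠ 0 := fun h0 => hq (by rw [e1, h0, zero_mul])
    linear_combination mul_right_cancel₀ h20 h2
  · intro s h1 h2 h3
    simp [h1, h2, h3]

end

/-! ### Leading coefficients and anisotropy -/

section
open Polynomial
variable {K ι : Type*} [Field K] [Fintype ι]

theorem coeff_wdot_C {c s : ι → K} (x : ι → K[X]) (n : ℕ) :
    (wdot (C ∘ c) x (C ∘ s)).coeff n = wdot c (fun i => (x i).coeff n) s := by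
  simp [wdot_apply, mul_assoc]

theorem coeff_wdot_of_natDegree_le {c : ι → K} {x y : ι → K[X]} {m n : ℕ}
    (hx : ∀ i, (x i).natDegree ≤ m) (hy : ∀ i, (y i).natDegree ≤ n) :
    (wdot (C ∘ c) x y).coeff (m + n) =
      wdot c (fun i => (x i).coeff m) (fun i => (y i).coeff n) := by
  simp [wdot_apply, mul_assoc, coeff_mul_add_eq_of_natDegree_le (hx _) (hy _)]

/-- Over an anisotropic form no cancellation of leading terms can occur, so that the degree of a
polynomial vector is at most half the degree of its length. -/
theorem Anisotropic.natDegree_le {c : ι → K} (hc : Anisotropic c) {x : ι → K[X]} {n : ℕ}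
    (h : (wdot (C ∘ c) x x).natDegree ≤ 2 * n) (i : ι) : (x i).natDegree ≤ n := by
  set N := Finset.univ.sup fun i => (x i).natDegree with hN
  have hle : ∀ j, (x j).natDegree ≤ N := fun j =>
    Finset.le_sup (f := fun i => (x i).natDegree) (Finset.mem_univ j)
  refine (hle i).trans ?_
  by_contra! hlt
  obtain ⟨j, -, hj⟩ := Finset.exists_mem_eq_sup Finset.univ ⟨i, Finset.mem_univ i⟩
    fun i => (x i).natDegree
  have h0 := coeff_wdot_of_natDegree_le (c := c) hle hle
  rw [coeff_eq_zero_of_natDegree_lt (by omega)] at h0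
  have h1 : (x j).coeff N = 0 := congrFun (hc _ h0.symm) j
  rw [hN, hj, coeff_natDegree, leadingCoeff_eq_zero] at h1
  rw [h1, natDegree_zero] at hj
  omega

theorem Anisotropic.polynomial {c : ι → K} (hc : Anisotropic c) :
    Anisotropic (C ∘ c : ι → K[X]) := by
  intro x hx
  have h0 := hc.natDegree_le (x := x) (n := 0) (by simp [hx])
  have h1 := coeff_wdot_of_natDegree_le (c := c) (m := 0) (n := 0)
    (fun i => h0 i) (fun i => h0 i)
  rw [hx, coeff_zero] at h1
  funext i
  rw [eq_C_of_natDegree_le_zero (h0 i)]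
  have := congrFun (hc _ h1.symm) i
  simp_all

/-! ### Polynomial representation -/

/-- Cassels' theorem: a polynomial `p` represented by an anisotropic form over `K(X)` is
represented over `K[X]`. Let `f / d` be a vector of length `p` and `g` its polynomial part. If
`f / d ≠ g`, the line through these two points meets the quadric of vectors of length `p` in a
second point, which has a denominator of smaller degree. -/
theorem exists_polynomial_rep {c : ι → K} (hc : Anisotropic c) (S : Set (ι → K)) {p : K[X]}
    (d : K[X]) (hd : d ≠ 0) (f : ι → K[X]) (hf : wdot (C ∘ c) f f = d ^ 2 * p)
    (hS : ∀ s ∈ S, wdot (C ∘ c) f (C ∘ s) = 0) :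
    ∃ y : ι → K[X], wdot (C ∘ c) y y = p ∧ ∀ s ∈ S, wdot (C ∘ c) y (C ∘ s) = 0 := by
  induction hn : d.natDegree using Nat.strong_induction_on generalizing d f with
  | _ n ih =>
  set g : ι → K[X] := fun i => f i / d with hg
  set r : ι → K[X] := fun i => f i % d with hr
  have hfr : f = d • g + r := by
    funext i
    simp only [hg, hr, Pi.add_apply, Pi.smul_apply, smul_eq_mul]
    exact (EuclideanDomain.div_add_mod _ _).symm
  have hrd : ∀ i, (r i).degree < d.degree := fun i => EuclideanDomain.mod_lt _ hd
  -- Orthogonality to constant vectors passes to the quotient by comparing degrees.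
  have hSg : ∀ s ∈ S, wdot (C ∘ c) g (C ∘ s) = 0 := by
    intro s hs
    have h1 := hS s hs
    rw [hfr, map_add, map_smul, LinearMap.add_apply, LinearMap.smul_apply, smul_eq_mul] at h1
    have h2 : (wdot (C ∘ c) r (C ∘ s)).degree < d.degree := by
      rw [wdot_apply]
      refine (degree_sum_le _ _).trans_lt ?_
      rw [Finset.sup_lt_iff (bot_lt_iff_ne_bot.mpr (degree_ne_bot.mpr hd))]
      intro i _
      refine lt_of_le_of_lt ?_ (hrd i)
      simp only [Function.comp_apply]
      rw [mul_right_comm, ← C_mul, ← smul_eq_C_mul]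
      exact degree_smul_le _ _
    have h3 : d ∣ wdot (C ∘ c) r (C ∘ s) := ⟨- wdot (C ∘ c) g (C ∘ s), by linear_combination h1⟩
    have h4 := eq_zero_of_dvd_of_degree_lt h3 h2
    rw [h4, add_zero] at h1
    exact (mul_eq_zero.mp h1).resolve_left hd
  by_cases hr0 : r = 0
  · refine ⟨g, ?_, hSg⟩
    rw [hfr, hr0, add_zero] at hf
    simp only [map_smul, LinearMap.smul_apply, smul_eq_mul] at hf
    exact mul_left_cancel₀ (pow_ne_zero 2 hd) (by linear_combination hf)
  -- `h` is the denominator of the second point. It has small degree because `d * h` is the length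
  -- of the remainder `r`, and it is nonzero because the form is anisotropic.
  set h := d * p - 2 * wdot (C ∘ c) f g + d * wdot (C ∘ c) g g with hh
  have hQr : wdot (C ∘ c) r r = d * h := by
    rw [show r = f - d • g by rw [hfr]; simp]
    simp only [map_sub, LinearMap.sub_apply, map_smul, LinearMap.smul_apply, smul_eq_mul, hf,
      wdot_comm _ g f, hh]
    ring
  have hh0 : h ≠ 0 := by
    rintro h0
    rw [h0, mul_zero] at hQr
    exact hr0 (hc.polynomial _ hQr)
  have hdpos : ∀ i, r i ≠ 0 → (r i).natDegree < d.natDegree := fun i hi =>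
    natDegree_lt_natDegree hi (hrd i)
  obtain ⟨j, hj⟩ := Function.ne_iff.mp hr0
  have hle : ∀ i, (r i).natDegree ≤ d.natDegree - 1 := fun i => by
    by_cases hi : r i = 0
    · simp [hi]
    · have := hdpos i hi
      omega
  have hdeg : (wdot (C ∘ c) r r).natDegree ≤ (d.natDegree - 1) + (d.natDegree - 1) := by
    rw [wdot_apply]
    refine natDegree_sum_le_of_forall_le _ _ fun i _ => ?_
    rw [mul_assoc]
    refine (natDegree_C_mul_le _ _).trans ?_
    exact natDegree_mul_le_of_le (hle i) (hle i)
  have hlt : h.natDegree < n := by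
    rw [hQr, natDegree_mul hd hh0] at hdeg
    have := hdpos j hj
    omega
  refine ih _ hlt h hh0 ((wdot (C ∘ c) g g - p) • f + (2 * (d * p - wdot (C ∘ c) f g)) • g)
    ?_ ?_ rfl
  · simp only [map_add, LinearMap.add_apply, map_smul, LinearMap.smul_apply, smul_eq_mul, hf,
      wdot_comm _ g f, hh]
    ring
  · intro s hs
    simp [hS s hs, hSg s hs]

/-- If a quadratic polynomial `a X² + b` is represented over `K(X)` by a form that is anisotropic
over `K`, it is represented by a linear polynomial vector `v X + u`. -/
theorem exists_linear_rep {c : ι → K} (hc : Anisotropic c) (S : Set (ι → K)) (h2 : (2 : K) ≠ 0)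
    {a b : K} {d : K[X]} (hd : d ≠ 0) {f : ι → K[X]}
    (hf : wdot (C ∘ c) f f = d ^ 2 * (C a * X ^ 2 + C b))
    (hS : ∀ s ∈ S, wdot (C ∘ c) f (C ∘ s) = 0) :
    ∃ u v : ι → K, wdot c v v = a ∧ wdot c u u = b ∧ wdot c u v = 0 ∧
      ∀ s ∈ S, wdot c u s = 0 ∧ wdot c v s = 0 := by
  obtain ⟨y, hy, hyS⟩ := exists_polynomial_rep hc S d hd f hf hS
  have hdeg : ∀ i, (y i).natDegree ≤ 1 := hc.natDegree_le (by
    rw [hy]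
    compute_degree)
  have hyl : y = (X : K[X]) • (C ∘ fun i => (y i).coeff 1) + C ∘ fun i => (y i).coeff 0 := by
    funext i
    simp only [Pi.add_apply, Pi.smul_apply, Function.comp_apply, smul_eq_mul]
    rw [X_mul_C]
    exact eq_X_add_C_of_natDegree_le_one (hdeg i)
  set v : ι → K := fun i => (y i).coeff 1 with hv
  set u : ι → K := fun i => (y i).coeff 0 with hu
  have key : C (wdot c v v) * X ^ 2 + C (2 * wdot c u v) * X + C (wdot c u u) =
      C a * X ^ 2 + C 0 * X + C b := by
    rw [C_0, zero_mul, add_zero, ← hy, hyl]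
    rw [wdot_smul_add, ← map_wdot C, ← map_wdot C, ← map_wdot C]
    simp only [map_mul, map_ofNat]
    ring
  have k0 := congrArg (fun q => coeff q 0) key
  have k1 := congrArg (fun q => coeff q 1) key
  have k2 := congrArg (fun q => coeff q 2) key
  simp [coeff_X, coeff_C, h2] at k0 k1 k2
  refine ⟨u, v, k2, k0, k1, fun s hs => ⟨?_, ?_⟩⟩
  · rw [hu, ← coeff_wdot_C, hyS s hs, coeff_zero]
  · rw [hv, ← coeff_wdot_C, hyS s hs, coeff_zero]

end

/-! ### Specialization of rational vectors -/

theorem exists_common_denominator {R K ι : Type*} [CommRing R] [IsDomain R] [Field K] [Algebra R K]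
    [IsFractionRing R K] [Finite ι] (x : ι → K) :
    ∃ e : R, e ≠ 0 ∧ ∃ y : ι → R, algebraMap R K ∘ y = algebraMap R K e • x := by
  obtain ⟨e, he⟩ := IsLocalization.exist_integer_multiples_of_finite (nonZeroDivisors R) x
  choose y hy using he
  refine ⟨e, nonZeroDivisors.ne_zero e.2, y, funext fun i => ?_⟩
  rw [Function.comp_apply, hy, Pi.smul_apply, smul_eq_mul, Algebra.smul_def]

theorem Anisotropic.fraction {R ι : Type*} (K : Type*) [CommRing R] [IsDomain R] [Field K]
    [Algebra R K] [IsFractionRing R K] [Fintype ι] {c : ι → R} (hc : Anisotropic c) :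
    Anisotropic (algebraMap R K ∘ c) := by
  intro x hx
  obtain ⟨e, he, y, hy⟩ := exists_common_denominator (R := R) x
  have he' : algebraMap R K e ≠ 0 := by simpa using he
  have hy0 : y = 0 := hc y (IsFractionRing.injective R K (by
    rw [map_wdot, hy, map_zero]
    simp [hx]))
  rw [hy0] at hy
  refine (smul_eq_zero.mp (hy.symm.trans ?_)).resolve_left he'
  funext i
  simp

section
open MvPolynomial
open scoped MonomialOrder
variable {F ι σ : Type*} [Field F] [Fintype ι]

theorem coeff_wdot_mvPolynomial {c s : ι → F} (x : ι → MvPolynomial σ F) (D : σ →₀ ℕ) :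
    (wdot (C ∘ c) x (C ∘ s)).coeff D = wdot c (fun i => (x i).coeff D) s := by
  simp only [wdot_apply, coeff_sum, Function.comp_apply, mul_assoc, coeff_C_mul,
    mul_comm _ (C (s _))]
  simp only [mul_left_comm, mul_comm]

theorem coeff_wdot_of_degree_le (m : MonomialOrder σ) {c : ι → F} {x : ι → MvPolynomial σ F}
    {D : σ →₀ ℕ} (hx : ∀ i, m.degree (x i) ≼[m] D) :
    (wdot (C ∘ c) x x).coeff (D + D) =
      wdot c (fun i => (x i).coeff D) (fun i => (x i).coeff D) := by
  simp only [wdot_apply, coeff_sum, Function.comp_apply, mul_assoc, coeff_C_mul,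
    m.coeff_mul_of_add_of_degree_le (hx _) (hx _)]

/-- Over an anisotropic form the leading terms of a polynomial vector cannot cancel. -/
theorem Anisotropic.exists_degree (m : MonomialOrder σ) {c : ι → F} (hc : Anisotropic c)
    {x : ι → MvPolynomial σ F} (hx : x ≠ 0) :
    ∃ D, (∀ i, m.degree (x i) ≼[m] D) ∧ (wdot (C ∘ c) x x).coeff (D + D) ≠ 0 := by
  classical
  obtain ⟨j, hj⟩ := Function.ne_iff.mp hx
  obtain ⟨k, hk, hmax⟩ := Finset.exists_max_image (Finset.univ.filter fun i => x i ≠ 0)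
    (fun i => m.toSyn (m.degree (x i))) ⟨j, by simpa using hj⟩
  have hle : ∀ i, m.degree (x i) ≼[m] m.degree (x k) := fun i => by
    by_cases hi : x i = 0
    · simp [hi]
    · exact hmax i (by simpa using hi)
  refine ⟨_, hle, ?_⟩
  rw [coeff_wdot_of_degree_le m hle]
  intro h0
  have h1 : (x k).coeff (m.degree (x k)) = 0 := congrFun (hc _ h0) k
  rw [m.coeff_degree_eq_zero_iff] at h1
  simp [h1] at hk

variable [LinearOrder σ] [WellFoundedGT σ]

theorem Anisotropic.mvPolynomial {c : ι → F} (hc : Anisotropic c) :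
    Anisotropic (C ∘ c : ι → MvPolynomial σ F) := by
  intro x hx
  by_contra h
  obtain ⟨D, -, hD⟩ := hc.exists_degree MonomialOrder.lex h
  simp [hx] at hD

/-- A nonzero constant represented by an anisotropic form over a rational function field is already
represented over the ground field: one takes the coefficients of a polynomial multiple `x` of the
given vector at the degree of the denominator `e`. -/
theorem Anisotropic.exists_rep_of_mvPolynomial {c : ι → F} (hc : Anisotropic c) (S : Set (ι → F))
    {a : F} (ha : a ≠ 0) {e : MvPolynomial σ F} (he : e ≠ 0) {x : ι → MvPolynomial σ F}
    (hx : wdot (C ∘ c) x x = e ^ 2 * C a) (hS : ∀ s ∈ S, wdot (C ∘ c) x (C ∘ s) = 0) :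
    ∃ v : ι → F, wdot c v v = a ∧ ∀ s ∈ S, wdot c v s = 0 := by
  let m : MonomialOrder σ := MonomialOrder.lex
  have hx0 : x ≠ 0 := by
    rintro rfl
    simp only [map_zero] at hx
    exact mul_ne_zero (pow_ne_zero 2 he) (C_eq_zero.not.mpr ha) hx.symm
  obtain ⟨D, hD, hDD⟩ := hc.exists_degree m hx0
  set E := m.degree e with hE
  have hl : m.leadingCoeff e ≠ 0 := m.leadingCoeff_ne_zero_iff.mpr he
  -- The length of `x` has degree `D + D` by anisotropy, and `E + E` by the equation.
  have hDE : D ≼[m] E := by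
    by_contra! hlt
    have h1 : D + D ≼[m] m.degree (wdot (C ∘ c) x x) := m.le_degree (mem_support_iff.mpr hDD)
    rw [hx, sq, m.degree_mul (mul_ne_zero he he) (C_eq_zero.not.mpr ha), m.degree_mul he he,
      m.degree_C, add_zero] at h1
    rw [map_add, map_add] at h1
    exact absurd h1 (not_le.mpr (add_lt_add hlt hlt))
  have hxE : ∀ i, m.degree (x i) ≼[m] E := fun i => (hD i).trans hDE
  have h1 := coeff_wdot_of_degree_le (c := c) m hxE
  rw [hx, mul_comm, coeff_C_mul, sq, m.coeff_mul_of_degree_add] at h1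
  refine ⟨(m.leadingCoeff e)⁻¹ • fun i => (x i).coeff E, ?_, fun s hs => ?_⟩
  · simp only [map_smul, LinearMap.smul_apply, smul_eq_mul, ← h1]
    field_simp
  · rw [map_smul, LinearMap.smul_apply, ← coeff_wdot_mvPolynomial, hS s hs, coeff_zero, smul_zero]

end

/-! ### The subform theorem -/

section
open MvPolynomial
variable {F ι : Type*} [Field F] [Fintype ι]

/-- Polynomials in `n + 1` variables are polynomials in the first variable over the rational
function field in the other ones. -/
theorem exists_hom_polynomial (F : Type*) [Field F] (n : ℕ) (K : Type*) [Field K]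
    [Algebra (MvPolynomial (Fin n) F) K] [IsFractionRing (MvPolynomial (Fin n) F) K] :
    ∃ ψ : MvPolynomial (Fin (n + 1)) F →+* Polynomial K, Function.Injective ψ ∧
      (∀ r, ψ (C r) = Polynomial.C (algebraMap (MvPolynomial (Fin n) F) K (C r))) ∧
      ψ (X 0) = Polynomial.X ∧
      ∀ i : Fin n, ψ (X i.succ) = Polynomial.C (algebraMap (MvPolynomial (Fin n) F) K (X i)) := by
  refine ⟨(Polynomial.mapRingHom (algebraMap (MvPolynomial (Fin n) F) K)).comp
    (finSuccEquiv F n : MvPolynomial (Fin (n + 1)) F →+* Polynomial (MvPolynomial (Fin n) F)),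
    ?_, ?_, ?_, ?_⟩
  · rw [RingHom.coe_comp]
    exact (Polynomial.map_injective _ (IsFractionRing.injective _ K)).comp
      (finSuccEquiv F n).injective
  · intro r
    simp [finSuccEquiv_apply]
  · simp [finSuccEquiv_X_zero]
  · intro i
    simp [finSuccEquiv_X_succ]

/-- One step of the subform theorem: splitting off the first variable. The representation is made
linear in that variable, its leading vector is moved to a vector `v₀` defined over the
ground field, and the remaining vector represents the rest of the diagonal form in the orthogonal
complement of `v₀`. -/
theorem exists_split_rep (K : Type*) {n : ℕ} [Field K]
    [Algebra (MvPolynomial (Fin n) F) K] [IsFractionRing (MvPolynomial (Fin n) F) K]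
    (h2 : (2 : F) ≠ 0) {c : ι → F} (hc : Anisotropic c)
    {a : Fin (n + 1) → F} (ha : a 0 ≠ 0) (S : Set (ι → F)) {d : MvPolynomial (Fin (n + 1)) F}
    (hd : d ≠ 0) {f : ι → MvPolynomial (Fin (n + 1)) F}
    (hf : wdot (C ∘ c) f f = d ^ 2 * ∑ i, C (a i) * X i ^ 2)
    (hS : ∀ s ∈ S, wdot (C ∘ c) f (C ∘ s) = 0) :
    ∃ v₀ : ι → F, wdot c v₀ v₀ = a 0 ∧ (∀ s ∈ S, wdot c v₀ s = 0) ∧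
      ∃ e : MvPolynomial (Fin n) F, e ≠ 0 ∧ ∃ y : ι → MvPolynomial (Fin n) F,
        wdot (C ∘ c) y y = e ^ 2 * ∑ i : Fin n, C (a i.succ) * X i ^ 2 ∧
        ∀ s ∈ insert v₀ S, wdot (C ∘ c) y (C ∘ s) = 0 := by
  let R := MvPolynomial (Fin n) F
  have hinj : Function.Injective (algebraMap R K) := IsFractionRing.injective R K
  let κ : F →+* K := (algebraMap R K).comp C
  have hκ : ∀ x : ι → F, κ ∘ x = algebraMap R K ∘ (C ∘ x) := fun x => rfl
  obtain ⟨ψ, hψinj, hψC, hψ0, hψs⟩ := exists_hom_polynomial F n K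
  have hψCc : ∀ x : ι → F, ψ ∘ (C ∘ x) = Polynomial.C ∘ (κ ∘ x) := fun x =>
    funext fun i => hψC _
  have hcK : Anisotropic (κ ∘ c) := hc.mvPolynomial.fraction K
  have hdψ : ψ d ≠ 0 := (map_ne_zero_iff ψ hψinj).mpr hd
  have hfψ : wdot (Polynomial.C ∘ (κ ∘ c)) (ψ ∘ f) (ψ ∘ f) = ψ d ^ 2 *
      (Polynomial.C (κ (a 0)) * Polynomial.X ^ 2 +
        Polynomial.C (algebraMap R K (∑ i : Fin n, C (a i.succ) * X i ^ 2))) := by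
    rw [← hψCc, ← map_wdot, hf, Fin.sum_univ_succ]
    simp only [map_mul, map_add, map_pow, map_sum, hψC, hψ0, hψs]
    rfl
  have h2K : (2 : K) ≠ 0 := by
    rw [← map_ofNat κ 2]
    exact (map_ne_zero κ).mpr h2
  obtain ⟨u, v, hv, hu, huv, hS'⟩ := exists_linear_rep hcK ((fun s => κ ∘ s) '' S) h2K hdψ hfψ (by
    rintro _ ⟨s, hs, rfl⟩
    rw [← hψCc, ← hψCc, ← map_wdot, hS s hs, map_zero])
  obtain ⟨v₀, hv₀, hSv₀⟩ : ∃ v₀ : ι → F, wdot c v₀ v₀ = a 0 ∧ ∀ s ∈ S, wdot c v₀ s = 0 := by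
    obtain ⟨e, he, y, hy⟩ := exists_common_denominator (R := R) v
    refine hc.exists_rep_of_mvPolynomial S ha he (x := y) (hinj ?_) fun s hs => hinj ?_
    · rw [map_wdot, hy, ← hκ]
      simp only [map_smul, LinearMap.smul_apply, smul_eq_mul, hv, map_mul, map_pow]
      rw [← mul_assoc, ← sq]
      rfl
    · rw [map_wdot, hy, ← hκ, map_smul, LinearMap.smul_apply, map_zero]
      exact smul_eq_zero_of_right _ (hS' _ ⟨s, hs, rfl⟩).2
  obtain ⟨u', hu', hu'v₀, hSu'⟩ := exists_reflect hcK (w := κ ∘ v₀)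
    (by rw [hv, ← map_wdot, hv₀]) huv
  obtain ⟨e, he, y, hy⟩ := exists_common_denominator (R := R) u'
  refine ⟨v₀, hv₀, hSv₀, e, he, y, hinj ?_, fun s hs => hinj ?_⟩
  · rw [map_wdot, hy, ← hκ]
    simp only [map_smul, LinearMap.smul_apply, smul_eq_mul, hu', hu]
    rw [map_mul, map_pow, ← mul_assoc, ← sq]
  · rw [map_wdot, hy, ← hκ, map_smul, LinearMap.smul_apply, map_zero]
    refine smul_eq_zero_of_right _ ?_
    rcases hs with rfl | hs
    · exact hu'v₀
    · obtain ⟨h3, h4⟩ := hS' _ ⟨s, hs, rfl⟩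
      refine hSu' _ h3 h4 ?_
      rw [← hκ, ← map_wdot, hSv₀ s hs, map_zero]

/-- The Cassels–Pfister subform theorem for diagonal forms, with denominators cleared: if an
anisotropic form represents the generic value `∑ i, a i * X i ^ 2` over the rational function
field, it contains orthogonal vectors of lengths `a i`. The set `S` of constant vectors
to which everything stays orthogonal carries the induction on the number of variables. -/
theorem exists_orthogonal_of_rep (h2 : (2 : F) ≠ 0) {c : ι → F} (hc : Anisotropic c) {n : ℕ}
    {a : Fin n → F} (ha : ∀ i, a i ≠ 0) (S : Set (ι → F)) {d : MvPolynomial (Fin n) F}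
    (hd : d ≠ 0) {f : ι → MvPolynomial (Fin n) F}
    (hf : wdot (C ∘ c) f f = d ^ 2 * ∑ i, C (a i) * X i ^ 2)
    (hS : ∀ s ∈ S, wdot (C ∘ c) f (C ∘ s) = 0) :
    ∃ v : Fin n → ι → F, (∀ i, wdot c (v i) (v i) = a i) ∧
      (∀ i j, i ≠ j → wdot c (v i) (v j) = 0) ∧ ∀ i, ∀ s ∈ S, wdot c (v i) s = 0 := by
  induction n generalizing S with
  | zero => exact ⟨fun i => i.elim0, fun i => i.elim0, fun i => i.elim0, fun i => i.elim0⟩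
  | succ n ih =>
  obtain ⟨v₀, hv₀, hSv₀, e, he, y, hy, hyS⟩ :=
    exists_split_rep (FractionRing (MvPolynomial (Fin n) F)) h2 hc (ha 0) S hd hf hS
  obtain ⟨w, hw, hww, hwS⟩ := ih (fun i => ha i.succ) (insert v₀ S) he hy hyS
  refine ⟨Fin.cons v₀ w, ?_, ?_, ?_⟩
  · exact Fin.cases hv₀ hw
  · refine Fin.cases (Fin.cases (fun h => absurd rfl h) fun j _ => ?_) fun i => Fin.cases
      (fun _ => ?_) fun j hij => ?_
    · simpa [wdot_comm c v₀] using hwS j v₀ (Set.mem_insert _ _)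
    · simpa using hwS i v₀ (Set.mem_insert _ _)
    · simpa using hww i j fun h => hij (congrArg Fin.succ h)
  · exact Fin.cases hSv₀ fun i s hs => hwS i s (Set.mem_insert_of_mem _ hs)

end
end DiagonalForm

/-! ### Quadratic forms in orthogonal coordinates -/

namespace DiagonalForm

theorem bilin_sum_smul {R M ι : Type*} [CommRing R] [AddCommGroup M] [Module R M] [Fintype ι]
    (B : LinearMap.BilinForm R M) {v : ι → M} (hv : ∀ i j, i ≠ j → B (v i) (v j) = 0)
    (x y : ι → R) :
    B (∑ i, x i • v i) (∑ i, y i • v i) = wdot (fun i => B (v i) (v i)) x y := by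
  simp only [map_sum, LinearMap.sum_apply, map_smul, LinearMap.smul_apply, smul_eq_mul, wdot_apply]
  refine Finset.sum_congr rfl fun i _ => ?_
  rw [Finset.sum_eq_single i (fun j _ hj => by simp [hv j i hj])
    (fun h => absurd (Finset.mem_univ i) h)]
  ring

variable {F V ι : Type*} [Field F] [AddCommGroup V] [Module F V] [Fintype ι]

theorem quadraticForm_sum_smul [Invertible (2 : F)] (q : QuadraticForm F V) {v : ι → V}
    (hv : ∀ i j, i ≠ j → QuadraticMap.associated (R := F) q (v i) (v j) = 0) (x : ι → F) :
    q (∑ i, x i • v i) = wdot (q ∘ v) x x := by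
  rw [← QuadraticMap.associated_eq_self_apply F q, bilin_sum_smul _ hv]
  simp only [QuadraticMap.associated_eq_self_apply]
  rfl

theorem baseChange_sum_tmul [Invertible (2 : F)] (K : Type*) [Field K] [Algebra F K]
    (q : QuadraticForm F V) {v : ι → V}
    (hv : ∀ i j, i ≠ j → QuadraticMap.associated (R := F) q (v i) (v j) = 0) (x : ι → K) :
    q.baseChange K (∑ i, x i ⊗ₜ[F] v i) = wdot (algebraMap F K ∘ q ∘ v) x x := by
  let : Invertible (2 : K) := (Invertible.map (algebraMap F K) 2).copy 2 (map_ofNat _ _).symm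
  have h : ∑ i, x i ⊗ₜ[F] v i = ∑ i, x i • ((1 : K) ⊗ₜ[F] v i) := by
    simp [TensorProduct.smul_tmul']
  rw [h, ← QuadraticMap.associated_eq_self_apply K (q.baseChange K), bilin_sum_smul]
  · congr 2
    refine congrArg wdot (funext fun i => ?_)
    rw [QuadraticMap.associated_eq_self_apply, QuadraticForm.baseChange_tmul]
    simp [Algebra.smul_def]
  · intro i j hij
    rw [QuadraticForm.associated_baseChange, LinearMap.BilinForm.baseChange_tmul, hv i j hij]
    simp

theorem algHom_wdot {A B : Type*} [CommRing A] [CommRing B] [Algebra F A] [Algebra F B]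
    (f : A →ₐ[F] B) (c : ι → F) (x y : ι → A) :
    f (wdot (algebraMap F A ∘ c) x y) = wdot (algebraMap F B ∘ c) (f ∘ x) (f ∘ y) := by
  simp [wdot_apply]

theorem exists_eq_sum_tmul (K : Type*) [Field K] [Algebra F K] (b : Module.Basis ι F V)
    (z : K ⊗[F] V) : ∃ x : ι → K, z = ∑ i, x i ⊗ₜ[F] b i := by
  refine ⟨fun i => (b.baseChange K).repr z i, ?_⟩
  conv_lhs => rw [← (b.baseChange K).sum_repr z]
  simp [TensorProduct.smul_tmul']

theorem sum_tmul_injective (K : Type*) [Field K] [Algebra F K] (b : Module.Basis ι F V)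
    {x y : ι → K} (h : ∑ i, x i ⊗ₜ[F] b i = ∑ i, y i ⊗ₜ[F] b i) : x = y := by
  have key : ∀ z : ι → K, ∑ i, z i ⊗ₜ[F] b i = ∑ i, z i • b.baseChange K i := fun z => by
    simp [TensorProduct.smul_tmul']
  rw [key, key] at h
  rw [← (b.baseChange K).repr_sum_self x, h, (b.baseChange K).repr_sum_self]

end DiagonalForm

/-! ### The projective class and the transfer to polynomials -/

namespace ProjectiveSubform

open DiagonalForm

variable {F V W ι : Type*} [Field F] [AddCommGroup V] [Module F V]
  [AddCommGroup W] [Module F W] [Fintype ι]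

theorem exists_coordRing_equiv (b : Module.Basis ι F W) :
    ∃ Φ : CoordRing F W ≃ₐ[F] MvPolynomial ι F,
      ∀ i, Φ (linearForm F W (b.coord i)) = MvPolynomial.X i := by
  classical
  refine ⟨(SymmetricAlgebra.equivMvPolynomial b.dualBasis :), fun i => ?_⟩
  rw [← b.coe_dualBasis]
  exact SymmetricAlgebra.equivMvPolynomial_ι_apply b.dualBasis i

/-- Over `F(W)`, an element of the projective class becomes a square multiple of the generic value
of the form. -/
theorem exists_toAffine_eq_of_mem_projectiveClass [Invertible (2 : F)] [FiniteDimensional F W]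
    {q : QuadraticForm F W} (b : Module.Basis ι F W)
    (hb : ∀ i j, i ≠ j → QuadraticMap.associated (R := F) q (b i) (b j) = 0)
    {p : ProjFunctionField F W} (hp : p ∈ projectiveClass q) :
    ∃ s : AffineFunctionField F W, s ≠ 0 ∧ toAffine F W p =
      s ^ 2 * wdot (algebraMap F (AffineFunctionField F W) ∘ q ∘ b)
        (fun i => linearFunction F W (b.coord i)) (fun i => linearFunction F W (b.coord i)) := by
  obtain ⟨δ, ⟨r, hr⟩, hδ0, c, hc, rfl⟩ := hp
  obtain ⟨x, rfl⟩ := exists_eq_sum_tmul (ProjFunctionField F W) b δ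
  have hx : toAffine F W ∘ x = r • fun i => linearFunction F W (b.coord i) := by
    refine sum_tmul_injective (AffineFunctionField F W) b ?_
    rw [genericPoint_eq_sum b, map_sum, Finset.smul_sum] at hr
    exact hr
  have hr0 : r ≠ 0 := by
    rintro rfl
    refine hδ0 (Finset.sum_eq_zero fun i _ => ?_)
    have h1 := congrFun hx i
    simp only [Function.comp_apply, zero_smul, Pi.zero_apply, map_eq_zero] at h1
    rw [h1, TensorProduct.zero_tmul]
  refine ⟨toAffine F W c * r, mul_ne_zero ((map_ne_zero _).mpr hc) hr0, ?_⟩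
  rw [baseChange_sum_tmul _ q hb, map_mul, map_pow, algHom_wdot, hx, map_smul, map_smul,
    LinearMap.smul_apply, smul_eq_mul, smul_eq_mul]
  ring

/-- The Cassels–Pfister subform theorem for diagonal forms, over the function field `F(W)` with the
coordinates of a basis of `W` as variables. -/
theorem exists_orthogonal_of_affine_rep (h2 : (2 : F) ≠ 0) {n : ℕ} {c : ι → F} (hc : Anisotropic c)
    (b : Module.Basis (Fin n) F W) {a : Fin n → F} (ha : ∀ i, a i ≠ 0)
    {z : ι → AffineFunctionField F W}
    (hz : wdot (algebraMap F (AffineFunctionField F W) ∘ c) z z =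
      wdot (algebraMap F (AffineFunctionField F W) ∘ a)
        (fun i => linearFunction F W (b.coord i)) (fun i => linearFunction F W (b.coord i))) :
    ∃ v : Fin n → ι → F, (∀ i, wdot c (v i) (v i) = a i) ∧
      ∀ i j, i ≠ j → wdot c (v i) (v j) = 0 := by
  obtain ⟨Φ, hΦ⟩ := exists_coordRing_equiv b
  obtain ⟨e, he, y, hy⟩ := exists_common_denominator (R := CoordRing F W) z
  have hinj := IsFractionRing.injective (CoordRing F W) (AffineFunctionField F W)
  let A := IsScalarTower.toAlgHom F (CoordRing F W) (AffineFunctionField F W)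
  have h1 : wdot (algebraMap F (CoordRing F W) ∘ c) y y =
      e ^ 2 * wdot (algebraMap F (CoordRing F W) ∘ a)
        (fun i => linearForm F W (b.coord i)) (fun i => linearForm F W (b.coord i)) := by
    refine hinj (show A _ = A _ from ?_)
    rw [algHom_wdot, map_mul, map_pow, algHom_wdot, show A ∘ y = A e • z from hy, map_smul,
      map_smul, LinearMap.smul_apply, hz, smul_eq_mul, smul_eq_mul, ← mul_assoc, ← sq]
    rfl
  have h3 := congrArg (Φ : CoordRing F W →ₐ[F] MvPolynomial (Fin n) F) h1
  rw [algHom_wdot, map_mul, algHom_wdot, map_pow] at h3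
  obtain ⟨v, h4, h5, -⟩ := exists_orthogonal_of_rep h2 hc ha ∅
    (d := Φ e) (by simpa using he) (f := Φ ∘ y) (h3.trans (by
      rw [wdot_apply]
      congr! 2 with i
      have hΦi : (Φ : CoordRing F W →ₐ[F] MvPolynomial (Fin n) F) (linearForm F W (b.coord i)) =
        MvPolynomial.X i := hΦ i
      simp only [Function.comp_apply, hΦi, MvPolynomial.algebraMap_eq]
      ring)) (by simp)
  exact ⟨v, h4, h5⟩

theorem isSubform_of_forall_map {q : QuadraticForm F W} {Q : QuadraticForm F V} {f : W →ₗ[F] V}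
    (hf : ∀ w, Q (f w) = q w) (hinj : Function.Injective f) : IsSubform q Q :=
  ⟨LinearMap.range f, ⟨{ LinearEquiv.ofInjective f hinj with map_app' := hf }⟩⟩

theorem represents_of_isSubform [Invertible (2 : F)] [FiniteDimensional F W]
    {qW : QuadraticForm F W} {qV : QuadraticForm F V} {l : F}
    {p : ProjFunctionField F W} (hp : p ∈ projectiveClass qW)
    (h : IsSubform (l • qW) qV) :
    Represents (qV.baseChange (ProjFunctionField F W))
      (algebraMap F (ProjFunctionField F W) l * p) := by
  obtain ⟨δ, -, -, c, -, rfl⟩ := hp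
  obtain ⟨U, ⟨g⟩⟩ := h
  let f : W →ₗ[F] V := U.subtype ∘ₗ g.toLinearEquiv.toLinearMap
  have hf : ∀ w, qV (f w) = l * qW w := fun w => g.map_app w
  have key : (qV.baseChange (ProjFunctionField F W)).comp (f.baseChange (ProjFunctionField F W)) =
      algebraMap F (ProjFunctionField F W) l • qW.baseChange (ProjFunctionField F W) := by
    refine baseChange_ext fun w => ?_
    simp [hf, Algebra.smul_def]
  refine ⟨c • f.baseChange (ProjFunctionField F W) δ, ?_⟩
  have h1 := congrArg (fun Q => Q δ) key
  simp only [QuadraticMap.comp_apply, smul_apply, smul_eq_mul] at h1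
  rw [QuadraticMap.map_smul, h1, smul_eq_mul]
  ring

/-- The diagonalizations of both forms turn the hypothesis into a representation of a generic
diagonal form; the resulting orthogonal vectors are the images of the basis of `W`. -/
theorem isSubform_of_represents [Invertible (2 : F)] [FiniteDimensional F V]
    [FiniteDimensional F W] {qV : QuadraticForm F V} {qW : QuadraticForm F W}
    (hV : qV.Anisotropic) (hW : (QuadraticMap.polarBilin qW).Nondegenerate)
    {p : ProjFunctionField F W} (hp : p ∈ projectiveClass qW) {l : F} (hl : l ≠ 0)
    (h : Represents (qV.baseChange (ProjFunctionField F W))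
      (algebraMap F (ProjFunctionField F W) l * p)) :
    IsSubform (l • qW) qV := by
  obtain ⟨bV, hbV'⟩ := LinearMap.BilinForm.exists_orthogonal_basis
    (QuadraticForm.associated_isSymm F qV)
  obtain ⟨bW, hbW'⟩ := LinearMap.BilinForm.exists_orthogonal_basis
    (QuadraticForm.associated_isSymm F qW)
  have hbV : ∀ i j, i ≠ j → QuadraticMap.associated (R := F) qV (bV i) (bV j) = 0 :=
    fun i j hij => hbV' hij
  have hbW : ∀ i j, i ≠ j → QuadraticMap.associated (R := F) qW (bW i) (bW j) = 0 :=
    fun i j hij => hbW' hij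
  have hpolar : ∀ x y, QuadraticMap.polarBilin qW x y =
      2 * QuadraticMap.associated (R := F) qW x y := fun x y => by
    rw [← QuadraticMap.two_nsmul_associated F, LinearMap.smul_apply, LinearMap.smul_apply,
      two_nsmul, two_mul]
  -- A vector of length zero in an orthogonal basis lies in the radical.
  have ha : ∀ i, l * qW (bW i) ≠ 0 := by
    intro i
    refine mul_ne_zero hl fun h0 => bW.ne_zero i (hW.1 _ fun w => ?_)
    rw [← bW.sum_repr w, map_sum]
    refine Finset.sum_eq_zero fun j _ => ?_
    rw [map_smul, hpolar]
    by_cases hij : i = j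
    · subst hij
      simp [QuadraticMap.associated_eq_self_apply, h0]
    · simp [hbW i j hij]
  have hc : Anisotropic (qV ∘ bV) := fun x hx => by
    rw [← quadraticForm_sum_smul qV hbV] at hx
    have h1 := hV _ hx
    exact funext fun i => Fintype.linearIndependent_iff.mp bV.linearIndependent x h1 i
  obtain ⟨u, hu⟩ := h
  obtain ⟨y, rfl⟩ := exists_eq_sum_tmul _ bV u
  rw [baseChange_sum_tmul _ qV hbV] at hu
  obtain ⟨s, hs, hps⟩ := exists_toAffine_eq_of_mem_projectiveClass bW hbW hp
  have h1 := congrArg (toAffine F W) hu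
  rw [algHom_wdot, map_mul, hps, AlgHom.commutes] at h1
  obtain ⟨v, hv, hvv⟩ := exists_orthogonal_of_affine_rep (Invertible.ne_zero 2) hc bW
    (a := fun i => l * qW (bW i)) ha
    (z := s⁻¹ • (toAffine F W ∘ y)) (by
      rw [map_smul, map_smul, LinearMap.smul_apply, h1]
      simp only [wdot_apply, Function.comp_apply, map_mul, smul_eq_mul, mul_assoc,
        ← Finset.mul_sum]
      field_simp)
  let f : W →ₗ[F] V := bW.constr F fun i => ∑ j, v i j • bV j
  have hfb : ∀ i, f (bW i) = ∑ j, v i j • bV j := fun i => bW.constr_basis F _ i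
  have hfo : ∀ i j, i ≠ j →
      QuadraticMap.associated (R := F) qV (f (bW i)) (f (bW j)) = 0 := fun i j hij => by
    rw [hfb, hfb, bilin_sum_smul _ hbV]
    simp only [QuadraticMap.associated_eq_self_apply]
    exact hvv i j hij
  have hf : ∀ w, qV (f w) = l * qW w := fun w => by
    rw [← bW.sum_repr w, quadraticForm_sum_smul qW hbW, map_sum]
    simp only [map_smul]
    rw [quadraticForm_sum_smul qV hfo]
    simp only [wdot_apply, Function.comp_apply, Finset.mul_sum]
    refine Finset.sum_congr rfl fun i _ => ?_
    rw [hfb, quadraticForm_sum_smul qV hbV, hv]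
    ring
  -- The kernel of `f` lies in the radical of `qW`.
  refine isSubform_of_forall_map hf ((injective_iff_map_eq_zero f).mpr fun w hw => ?_)
  refine hW.1 _ fun w' => ?_
  have h3 : l * QuadraticMap.polar qW w w' = 0 := by
    simp only [QuadraticMap.polar, mul_sub, ← hf, map_add, hw, zero_add, map_zero]
    ring
  exact (mul_eq_zero.mp h3).resolve_left hl

end ProjectiveSubform

theorem mainTheorem7 {F V W : Type*} [Field F] [Invertible (2 : F)]
    [AddCommGroup V] [Module F V] [FiniteDimensional F V]
    [AddCommGroup W] [Module F W] [FiniteDimensional F W] [Nontrivial W]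
    (qV : QuadraticForm F V) (qW : QuadraticForm F W)
    (hV : qV.Anisotropic) (hW : (QuadraticMap.polarBilin qW).Nondegenerate)
    (p : ProjectiveSubform.ProjFunctionField F W)
    (hp : p ∈ ProjectiveSubform.projectiveClass qW) :
    (∃ l : Fˣ, ProjectiveSubform.IsSubform ((l : F) • qW) qV) ↔
      ∃ l : Fˣ, ProjectiveSubform.Represents
        (qV.baseChange (ProjectiveSubform.ProjFunctionField F W))
        (algebraMap F (ProjectiveSubform.ProjFunctionField F W) (l : F) * p) :=
  ⟨fun ⟨l, h⟩ => ⟨l, ProjectiveSubform.represents_of_isSubform hp h⟩,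
    fun ⟨l, h⟩ => ⟨l, ProjectiveSubform.isSubform_of_represents hV hW hp l.ne_zero h⟩⟩
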